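/- Let $G$ be a group, let $A$ be a finite set with a map $A\to G$, let $\pi\colon A^*\to G$ be the induced homomorphism from the free monoid on $A$, and suppose that $\pi$ is surjective, that $\pi(A)=\pi(A)^{-1}$ and that $1_G\in\pi(A)$. Let $d_A$ be the combinatorial metric on the Cayley graph of $G$ with respect to $A$. For a path $p$ in the Cayley graph, let $\hat p(t)$ be its $t$-th vertex if $0\le t\le |p|$, and its final vertex if $t>|p|$ or $t=\infty$. Let $\mathcal L\subseteq A^*$ be such that $(A,\mathcal L)$ is a uniformly finite-to-one biautomatic structure on $G$, that is: (i) $\mathcal L$ is recognised by a finite state automaton over $A$; (ii) there is $N\ge 1$ such that $1\le |\pi^{-1}(g)\cap\mathcal L|\le N$ for every $g\in G$; (iii) there is $\zeta\ge 1$ such that if $p,q$ are paths in the Cayley graph labelled by words in $\mathcal L$ with $d_A(\hat p(0),\hat q(0))\le 1$ and $d_A(\hat p(\infty),\hat q(\infty))\le 1$, then $d_A(\hat p(t),\hat q(t))\le\zeta$ for all $t\ge 0$. Let $g\in G$, and for each $n\ge 1$ let $w_n\in\mathcal L$ be any word representing $g^n$ (that is, $\pi(w_n)=g^n$). Then the sequence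 $(|w_n|/n)_{n\ge 1}$ converges and its limit is a rational number. Consequently, writing $|h|_{\mathcal L}$ for the length of a shortest word in $\mathcal L$ representing $h\in G$, the stable $\mathcal L$-word length $\tau_{\mathcal L}(g):=\lim_{n\to\infty}|g^n|_{\mathcal L}/n$ exists, is rational, and equals $\lim_{n\to\infty}|w_n|/n$ for every choice of the words $w_n$. -/

import Mathlib

open Filter Topology
open scoped Pointwise

namespace Biaut

universe u v

variable {G : Type u} [Group G] {A : Type v}

/-- The element of `G` labelled by a word in the free monoid on `A`, for a map `ev : A → G`. -/
def wordEval (ev : A → G) (w : List A) : G := (w.map ev).prod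

/-- The combinatorial metric on the Cayley graph of `G` with respect to `ev : A → G`
(edges join `x` to `x * ev a`). -/
noncomputable def cayleyDist (ev : A → G) (x y : G) : ℕ :=
  (SimpleGraph.mulCayley (Set.range ev)).dist x y

/-- The `t`-th vertex of the path in the Cayley graph that starts at `x` and is labelled by `w`;
it is the final vertex of the path when `t` exceeds the length of `w`. -/
def pathVertex (ev : A → G) (x : G) (w : List A) (t : ℕ) : G := x * wordEval ev (w.take t)

/-- The final vertex of the path in the Cayley graph that starts at `x` and is labelled by `w`. -/
def pathEnd (ev : A → G) (x : G) (w : List A) : G := x * wordEval ev w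

/-- `(A, L)` is a uniformly finite-to-one biautomatic structure on `G`; the finite set `A` is
regarded as a generating set through `ev : A → G`. -/
structure IsBiautomaticStructure (ev : A → G) (L : Language A) : Prop where
  finite : Finite A
  /-- `A` generates `G` as a monoid -/
  generates : Function.Surjective (wordEval ev)
  symmetric : (Set.range ev)⁻¹ = Set.range ev
  one_mem : (1 : G) ∈ Set.range ev
  /-- `L` is recognised by a finite state automaton over `A` -/
  regular : L.IsRegular
  finite_to_one : ∃ N : ℕ, 1 ≤ N ∧ ∀ g : G,
    1 ≤ {w : List A | w ∈ L ∧ wordEval ev w = g}.encard ∧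
      {w : List A | w ∈ L ∧ wordEval ev w = g}.encard ≤ N
  /-- the two-sided fellow traveller property -/
  fellow_traveller : ∃ ζ : ℕ, 1 ≤ ζ ∧ ∀ p ∈ L, ∀ q ∈ L, ∀ x y : G,
    cayleyDist ev x y ≤ 1 →
    cayleyDist ev (pathEnd ev x p) (pathEnd ev y q) ≤ 1 →
    ∀ t : ℕ, cayleyDist ev (pathVertex ev x p t) (pathVertex ev y q t) ≤ ζ

/-- The `L`-word length of `g`: the length of a shortest word in `L` representing `g`. -/
noncomputable def wordLength (ev : A → G) (L : Language A) (g : G) : ℕ :=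
  sInf {n : ℕ | ∃ w ∈ L, wordEval ev w = g ∧ w.length = n}

/-- The stable `L`-word length of `g`: the limit of `|gⁿ|_L / n`. -/
noncomputable def stableLength (ev : A → G) (L : Language A) (g : G) : ℝ :=
  limUnder atTop fun n : ℕ => (wordLength ev L (g ^ n) : ℝ) / n

end Biaut

/-!
Let `Z` be the centre of the centralizer of `g`. Centralizers of finite sets are quasiconvex, hence
finitely generated, so `Z` is the centralizer of a finite set `S`. Since conjugates of `S` along
words of `L` representing powers of `g` range over a finite set, a finite automaton can remember
them, and each of its loops then represents, up to conjugation, an element of the abelian group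
`Z`.

By Higman's lemma, among words of `L` representing the powers of `g` there are two, for `g ^ i` and
`g ^ j` with `i < j`, such that the second arises from the first by inserting loops. As the loops
commute, inserting all of them `k` times represents `g ^ (i + k * (j - i))` by a word of `L` whose
length is affine in `k`. Words of `L` representing elements at bounded distance have lengths at
bounded distance, because `L` is finite-to-one, so the lengths of all words representing `g ^ n`
agree with a rational multiple of `n` up to a bounded error.
-/

namespace Biaut

section Words

variable {G : Type*} [Group G] {A : Type*} (ev : A → G)

@[simp] lemma wordEval_nil : wordEval ev [] = 1 := rfl

@[simp] lemma wordEval_cons (a : A) (w : List A) :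
    wordEval ev (a :: w) = ev a * wordEval ev w := by
  simp [wordEval]

@[simp] lemma wordEval_append (v w : List A) :
    wordEval ev (v ++ w) = wordEval ev v * wordEval ev w := by
  simp [wordEval]

@[simp] lemma wordEval_flatten_replicate (w : List A) (k : ℕ) :
    wordEval ev (List.replicate k w).flatten = wordEval ev w ^ k := by
  simp [wordEval, List.map_flatten, List.prod_flatten]

lemma evalFrom_flatten_replicate {σ : Type*} (M : DFA A σ) {s : σ} {w : List A}
    (h : M.evalFrom s w = s) (k : ℕ) : M.evalFrom s (List.replicate k w).flatten = s :=
  M.evalFrom_of_pow h <| Language.mem_kstar.2 ⟨_, rfl, fun _ hv => List.eq_of_mem_replicate hv⟩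

/-- The hypothesis `hH` is quasiconvexity of `H`: a path that stays near `H` is shadowed by elements
of `H` whose successive quotients lie in a fixed finite set. -/
theorem fg_of_forall_prefix_mem_mul [Finite A] {H : Subgroup G} {F : Set G} (hF : F.Finite)
    (hH : ∀ h ∈ H, ∃ w, wordEval ev w = h ∧ ∀ v, v <+: w → wordEval ev v ∈ (H : Set G) * F) :
    H.FG := by
  set F' : Set G := insert 1 F
  set S : Set G := H ∩ (F' * insert 1 (Set.range ev) * F'⁻¹)
  have hSH : Subgroup.closure S ≤ H := (Subgroup.closure_le _).2 Set.inter_subset_left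
  have mem_closure : ∀ c ∈ Subgroup.closure S, ∀ f ∈ F', ∀ b ∈ insert 1 (Set.range ev),
      ∀ f' ∈ F', ∀ h ∈ H, c * f * b = h * f' → h ∈ Subgroup.closure S := by
    intro c hc f hf b hb f' hf' h hh heq
    have hquot : c⁻¹ * h = f * b * f'⁻¹ := by
      rw [eq_mul_inv_iff_mul_eq, mul_assoc, ← heq]; group
    have hmem : c⁻¹ * h ∈ S := ⟨H.mul_mem (H.inv_mem (hSH hc)) hh,
      hquot ▸ Set.mul_mem_mul (Set.mul_mem_mul hf hb) (Set.inv_mem_inv.2 hf')⟩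
    simpa using Subgroup.mul_mem _ hc (Subgroup.subset_closure hmem)
  have hprefix : ∀ w, (∀ v, v <+: w → wordEval ev v ∈ (H : Set G) * F) →
      wordEval ev w ∈ (Subgroup.closure S : Set G) * F' := by
    intro w
    induction w using List.reverseRecOn with
    | nil => exact fun _ => ⟨1, one_mem _, 1, Set.mem_insert _ _, by simp⟩
    | append_singleton w a ih =>
      intro hw
      obtain ⟨c, hc, f, hf, hcf⟩ := ih fun v hv => hw v (hv.trans (List.prefix_append _ _))
      obtain ⟨h, hh, f', hf', hhf⟩ := hw _ List.prefix_rfl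
      have hf'' : f' ∈ F' := Set.mem_insert_of_mem _ hf'
      refine ⟨h, mem_closure c hc f hf (ev a)
        (Set.mem_insert_of_mem _ ⟨a, rfl⟩) f' hf'' h hh ?_, f', hf'', hhf⟩
      simpa [hcf] using hhf.symm
  refine (Subgroup.fg_iff H).2 ⟨S, le_antisymm hSH fun h hh => ?_, ?_⟩
  · obtain ⟨w, rfl, hw⟩ := hH h hh
    obtain ⟨c, hc, f, hf, hcf⟩ := hprefix w hw
    exact mem_closure c hc f hf 1 (Set.mem_insert _ _) 1 (Set.mem_insert _ _) _ hh
      (by simpa using hcf)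
  · have hF' : F'.Finite := hF.insert 1
    exact ((hF'.mul ((Set.finite_range ev).insert 1)).mul hF'.inv).inter_of_right _

end Words

section CayleyGraph

variable {G : Type*} [Group G] {A : Type*} {ev : A → G}

lemma cayleyDist_mul_le_one (x : G) (a : A) : cayleyDist ev x (x * ev a) ≤ 1 := by
  by_cases h : x = x * ev a
  · simp [cayleyDist, ← h]
  · exact (SimpleGraph.dist_eq_one_iff_adj.2 <|
      (SimpleGraph.mulCayley_adj' _ _ _).2 ⟨h, ev a, (Set.mem_range_self a), Or.inl rfl⟩).le

lemma reachable_mul_wordEval (x : G) (w : List A) :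
    (SimpleGraph.mulCayley (Set.range ev)).Reachable x (x * wordEval ev w) := by
  induction w generalizing x with
  | nil => simp
  | cons a w ih =>
    rw [wordEval_cons, ← mul_assoc]
    refine SimpleGraph.Reachable.trans ?_ (ih (x * ev a))
    by_cases h : x = x * ev a
    · rw [← h]
    · exact SimpleGraph.Adj.reachable
        ((SimpleGraph.mulCayley_adj' _ _ _).2 ⟨h, ev a, ⟨a, rfl⟩, Or.inl rfl⟩)

lemma exists_word_of_walk (hsymm : (Set.range ev)⁻¹ = Set.range ev) {x y : G}
    (p : (SimpleGraph.mulCayley (Set.range ev)).Walk x y) :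
    ∃ w : List A, w.length = p.length ∧ x * wordEval ev w = y := by
  induction p with
  | nil => exact ⟨[], by simp⟩
  | @cons x y z hadj p ih =>
    obtain ⟨w, hw, hwy⟩ := ih
    obtain ⟨a, ha⟩ : x⁻¹ * y ∈ Set.range ev := by
      rcases ((SimpleGraph.mulCayley_adj _ _ _).1 hadj).2 with h | h
      · exact h
      · rw [← hsymm]
        simpa using h
    exact ⟨a :: w, by simp [hw], by rw [wordEval_cons, ha, ← hwy]; group⟩

lemma exists_word_length_eq_cayleyDist (hgen : Function.Surjective (wordEval ev))
    (hsymm : (Set.range ev)⁻¹ = Set.range ev) (x y : G) :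
    ∃ w : List A, w.length = cayleyDist ev x y ∧ x * wordEval ev w = y := by
  obtain ⟨v, hv⟩ := hgen (x⁻¹ * y)
  have hxy : (SimpleGraph.mulCayley (Set.range ev)).Reachable x y := by
    simpa [hv] using reachable_mul_wordEval (ev := ev) x v
  obtain ⟨p, hp⟩ := hxy.exists_walk_length_eq_dist
  obtain ⟨w, hw, hwy⟩ := exists_word_of_walk hsymm p
  exact ⟨w, hw.trans hp, hwy⟩

lemma finite_setOf_inv_mul_of_cayleyDist_le [Finite A] (hgen : Function.Surjective (wordEval ev))
    (hsymm : (Set.range ev)⁻¹ = Set.range ev) (r : ℕ) :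
    {h : G | ∃ x y, cayleyDist ev x y ≤ r ∧ x⁻¹ * y = h}.Finite := by
  refine ((List.finite_length_le A r).image (wordEval ev)).subset ?_
  rintro _ ⟨x, y, hxy, rfl⟩
  obtain ⟨w, hw, rfl⟩ := exists_word_length_eq_cayleyDist hgen hsymm x y
  exact ⟨w, hw.trans_le hxy, by group⟩

lemma closure_range_eq_top (hgen : Function.Surjective (wordEval ev)) :
    Submonoid.closure (Set.range ev) = ⊤ := by
  refine (Submonoid.eq_top_iff' _).2 fun x => ?_
  obtain ⟨w, rfl⟩ := hgen x
  refine Submonoid.list_prod_mem _ fun y hy => ?_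
  obtain ⟨a, -, rfl⟩ := List.mem_map.1 hy
  exact Submonoid.subset_closure ⟨a, rfl⟩

end CayleyGraph

section FellowTraveller

variable {G : Type*} [Group G] {A : Type*} {ev : A → G} {L : Language A}

lemma IsBiautomaticStructure.exists_word (hL : IsBiautomaticStructure ev L) (h : G) :
    ∃ w ∈ L, wordEval ev w = h := by
  obtain ⟨N, -, hN⟩ := hL.finite_to_one
  obtain ⟨w, hw⟩ := Set.one_le_encard_iff_nonempty.1 (hN h).1
  exact ⟨w, hw.1, hw.2⟩

lemma IsBiautomaticStructure.finite_words (hL : IsBiautomaticStructure ev L) (h : G) :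
    {w : List A | w ∈ L ∧ wordEval ev w = h}.Finite := by
  obtain ⟨N, -, hN⟩ := hL.finite_to_one
  exact Set.finite_of_encard_le_coe (hN h).2

variable (ev L) in
/-- The fellow traveller property for paths with arbitrary endpoints: any two words `p, q ∈ L`
labelling paths whose initial vertices differ by `h` and whose terminal vertices differ by `h'`
stay within a finite set of differences of each other. -/
def FellowTravels (h h' : G) : Prop :=
  ∃ E : Set G, E.Finite ∧ ∀ p ∈ L, ∀ q ∈ L, h * wordEval ev q = wordEval ev p * h' →
    ∀ t : ℕ, (wordEval ev (p.take t))⁻¹ * h * wordEval ev (q.take t) ∈ E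

lemma FellowTravels.mul (hsurj : ∀ h, ∃ w ∈ L, wordEval ev w = h) {h₁ h₁' h₂ h₂' : G}
    (H₁ : FellowTravels ev L h₁ h₁') (H₂ : FellowTravels ev L h₂ h₂') :
    FellowTravels ev L (h₁ * h₂) (h₁' * h₂') := by
  obtain ⟨E₁, hE₁, H₁⟩ := H₁
  obtain ⟨E₂, hE₂, H₂⟩ := H₂
  refine ⟨E₁ * E₂, hE₁.mul hE₂, fun p hp q hq hpq t => ?_⟩
  obtain ⟨r, hr, hre⟩ := hsurj (h₁⁻¹ * wordEval ev p * h₁')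
  have hpr := H₁ p hp r hr (by rw [hre]; group) t
  have hrq := H₂ r hr q hq (by rw [hre, mul_assoc _ h₁' h₂', mul_assoc, ← hpq]; group) t
  convert Set.mul_mem_mul hpr hrq using 1
  group

lemma fellowTravels_letter (hL : IsBiautomaticStructure ev L) (a b : A) :
    FellowTravels ev L (ev a) (ev b) := by
  have := hL.finite
  obtain ⟨ζ, -, hζ⟩ := hL.fellow_traveller
  refine ⟨_, finite_setOf_inv_mul_of_cayleyDist_le hL.generates hL.symmetric ζ,
    fun p hp q hq hpq t => ⟨_, _, hζ p hp q hq 1 (ev a) ?_ ?_ t, ?_⟩⟩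
  · simpa using cayleyDist_mul_le_one (ev := ev) 1 a
  · simpa [pathEnd, hpq] using cayleyDist_mul_le_one (ev := ev) (wordEval ev p) b
  · simp [pathVertex, mul_assoc]

theorem fellowTravels (hL : IsBiautomaticStructure ev L) (h h' : G) :
    FellowTravels ev L h h' := by
  have hmem : (h, h') ∈ Submonoid.closure (Set.range ev ×ˢ Set.range ev) := by
    simp [Submonoid.closure_prod hL.one_mem hL.one_mem, closure_range_eq_top hL.generates]
  suffices ∀ x ∈ Submonoid.closure (Set.range ev ×ˢ Set.range ev),
    FellowTravels ev L x.1 x.2 from this _ hmem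
  intro x hx
  induction hx using Submonoid.closure_induction with
  | mem x hx =>
    obtain ⟨⟨a, ha⟩, b, hb⟩ := hx
    exact ha ▸ hb ▸ fellowTravels_letter hL a b
  | one =>
    obtain ⟨e, he⟩ := hL.one_mem
    simpa [he] using fellowTravels_letter hL e e
  | mul x y _ _ hx hy => exact hx.mul hL.exists_word hy

end FellowTraveller

section WordLengths

variable {G : Type*} [Group G] {A : Type*} {ev : A → G} {L : Language A}
  {σ : Type*} {M : DFA A σ}

lemma eq_nil_of_loop (hfin : ∀ h, {w | w ∈ M.accepts ∧ wordEval ev w = h}.Finite)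
    {x u y : List A} (hmem : x ++ u ++ y ∈ M.accepts) (hloop : M.eval (x ++ u) = M.eval x)
    (hu : wordEval ev (x ++ u) = wordEval ev x) : u = [] := by
  by_contra hne
  rw [wordEval_append, mul_eq_left] at hu
  rw [DFA.eval, DFA.evalFrom_of_append] at hloop
  let pump (k : ℕ) : List A := x ++ (List.replicate k u).flatten ++ y
  have hinj : Function.Injective pump := by
    intro k l hkl
    have hlen := congrArg List.length hkl
    simp only [pump, List.length_append, List.length_flatten, List.map_replicate,
      List.sum_replicate, smul_eq_mul, Nat.add_right_cancel_iff, Nat.add_left_cancel_iff] at hlen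
    exact Nat.eq_of_mul_eq_mul_right (List.length_pos_iff.2 hne) hlen
  refine Set.infinite_of_injective_forall_mem hinj (fun k => ?_) (hfin (wordEval ev (x ++ y)))
  refine ⟨?_, ?_⟩
  · rw [DFA.mem_accepts, DFA.eval] at hmem ⊢
    simp only [pump, DFA.evalFrom_of_append] at hmem ⊢
    rwa [evalFrom_flatten_replicate M hloop, ← hloop]
  · simp [pump, hu]

lemma injOn_eval_wordEval_take (hfin : ∀ h, {w | w ∈ M.accepts ∧ wordEval ev w = h}.Finite)
    {p : List A} (hp : p ∈ M.accepts) :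
    Set.InjOn (fun t => (M.eval (p.take t), wordEval ev (p.take t))) (Set.Iic p.length) := by
  intro i hi j hj hij
  wlog hle : i ≤ j generalizing i j
  · exact (this hj hi hij.symm (le_of_not_ge hle)).symm
  obtain ⟨u, hu⟩ : p.take i <+: p.take j := List.take_prefix_take_left hle
  simp only [← hu, Prod.mk.injEq] at hij
  have hnil : u = [] := eq_nil_of_loop hfin (y := p.drop j)
    (by rwa [hu, List.take_append_drop]) hij.1.symm hij.2.symm
  have hlen := congrArg List.length hu
  simp only [hnil, List.append_nil, List.length_take] at hlen
  rwa [min_eq_left hi, min_eq_left hj] at hlen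

theorem exists_length_le_add (hL : IsBiautomaticStructure ev L) (h h' : G) :
    ∃ C : ℕ, ∀ p ∈ L, ∀ q ∈ L, h * wordEval ev q = wordEval ev p * h' →
      p.length ≤ q.length + C := by
  obtain ⟨σ, _, M, rfl⟩ := hL.regular
  obtain ⟨E, hE, hFT⟩ := fellowTravels hL h h'
  refine ⟨(Finset.univ ×ˢ hE.toFinset : Finset (σ × G)).card, fun p hp q hq hpq => ?_⟩
  let f (t : ℕ) : σ × G :=
    (M.eval (p.take t), (wordEval ev (p.take t))⁻¹ * h * wordEval ev (q.take t))
  -- After time `|q|` the second path is constant, so its distance to the first one determines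
  -- the vertex of the first one.
  have hinj : Set.InjOn f (Finset.Icc q.length p.length) := by
    intro i hi j hj hij
    rw [Finset.coe_Icc, Set.mem_Icc] at hi hj
    refine injOn_eval_wordEval_take hL.finite_words hp hi.2 hj.2 ?_
    simpa [f, List.take_of_length_le hi.1, List.take_of_length_le hj.1] using hij
  have hcard := Finset.card_le_card_of_injOn f (t := Finset.univ ×ˢ hE.toFinset)
    (fun t _ => by simpa [f] using hFT p hp q hq hpq t) hinj
  rw [Nat.card_Icc] at hcard
  omega

lemma exists_abs_length_sub_le (hL : IsBiautomaticStructure ev L) {F : Set G} (hF : F.Finite) :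
    ∃ C : ℕ, ∀ p ∈ L, ∀ q ∈ L, wordEval ev p * (wordEval ev q)⁻¹ ∈ F →
      |(p.length : ℝ) - q.length| ≤ C := by
  choose C hC using fun h => exists_length_le_add hL h 1
  obtain ⟨B, hB⟩ := (hF.image fun h => max (C h) (C h⁻¹)).bddAbove
  refine ⟨B, fun p hp q hq hpq => ?_⟩
  have hmax := max_le_iff.1 (hB (Set.mem_image_of_mem _ hpq))
  have hpq_le := hC (wordEval ev p * (wordEval ev q)⁻¹) p hp q hq (by group)
  have hqp_le := hC (wordEval ev p * (wordEval ev q)⁻¹)⁻¹ q hq p hp (by group)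
  have hp_le : (p.length : ℝ) ≤ q.length + B := by exact_mod_cast (by omega)
  have hq_le : (q.length : ℝ) ≤ p.length + B := by exact_mod_cast (by omega)
  exact abs_le.2 ⟨by linarith, by linarith⟩

end WordLengths

section Centralizer

variable {G : Type*} [Group G] {A : Type*} {ev : A → G} {L : Language A} {S : Set G}

/-- The simultaneous conjugate of the elements of `S` by `x`. It determines the coset of `x`
modulo the centralizer of `S`. -/
def conjTuple (S : Set G) (x : G) : S → G := fun s => x⁻¹ * s * x

lemma conjTuple_eq_iff {x y : G} :
    conjTuple S x = conjTuple S y ↔ y * x⁻¹ ∈ Subgroup.centralizer S := by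
  simp only [funext_iff, Subtype.forall, conjTuple, Subgroup.mem_centralizer_iff]
  refine forall₂_congr fun s _ => ?_
  rw [← mul_right_inj y, ← mul_left_inj x⁻¹, eq_comm]
  simp only [mul_assoc, mul_inv_cancel, mul_one, mul_inv_cancel_left]

lemma finite_conjTuple_prefix (hL : IsBiautomaticStructure ev L) (hS : S.Finite) :
    {c | ∃ w ∈ L, wordEval ev w ∈ Subgroup.centralizer S ∧
      ∃ v, v <+: w ∧ conjTuple S (wordEval ev v) = c}.Finite := by
  have := hS.to_subtype
  choose E hE hFT using fun s : S => fellowTravels hL (s : G) s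
  refine (Set.Finite.pi' hE).subset ?_
  rintro _ ⟨w, hw, hwS, v, hv, rfl⟩ s
  rw [List.prefix_iff_eq_take.1 hv]
  exact hFT s w hw w hw (hwS s s.2) v.length

theorem centralizer_fg (hL : IsBiautomaticStructure ev L) (hS : S.Finite) :
    (Subgroup.centralizer S).FG := by
  have := hL.finite
  let P : Set G := {x | ∃ w ∈ L, wordEval ev w ∈ Subgroup.centralizer S ∧
    ∃ v, v <+: w ∧ wordEval ev v = x}
  have hP : (conjTuple S '' P).Finite := by
    refine (finite_conjTuple_prefix hL hS).subset ?_
    rintro _ ⟨_, ⟨w, hw, hwS, v, hv, rfl⟩, rfl⟩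
    exact ⟨w, hw, hwS, v, hv, rfl⟩
  obtain ⟨F, -, hF⟩ := Set.SurjOn.exists_bijOn_subset (Set.surjOn_image (conjTuple S) P)
  refine fg_of_forall_prefix_mem_mul ev (hF.finite_iff_finite.2 hP) fun h hh => ?_
  obtain ⟨w, hw, rfl⟩ := hL.exists_word h
  refine ⟨w, rfl, fun v hv => ?_⟩
  obtain ⟨f, hf, hfv⟩ := hF.surjOn (Set.mem_image_of_mem _ ⟨w, hw, hh, v, hv, rfl⟩)
  exact ⟨_, conjTuple_eq_iff.1 hfv, f, hf, by group⟩

lemma exists_finite_isMulCommutative_centralizer (hL : IsBiautomaticStructure ev L) (g : G) :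
    ∃ S : Set G, S.Finite ∧ g ∈ Subgroup.centralizer S ∧
      IsMulCommutative (Subgroup.centralizer S) := by
  obtain ⟨S, hSg, hS⟩ := (Subgroup.fg_iff _).1 (centralizer_fg hL (Set.finite_singleton g))
  have hg : {g} ⊆ (Subgroup.centralizer {g} : Set G) := by
    simp [Subgroup.mem_centralizer_singleton_iff]
  have hcentralizer : Subgroup.centralizer S = Subgroup.centralizer (Subgroup.centralizer {g}) := by
    rw [← hSg, Subgroup.centralizer_closure]
  refine ⟨S, hS, ?_, Subgroup.le_centralizer_iff_isMulCommutative.1 ?_⟩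
  · rw [hcentralizer, Subgroup.mem_centralizer_iff]
    exact fun h hh => (Subgroup.mem_centralizer_singleton_iff.1 hh)
  · rw [hcentralizer]
    exact Subgroup.centralizer_le (Subgroup.centralizer_le hg)

end Centralizer

section LoopExtension

variable {A τ : Type*} (N : DFA A τ)

/-- `LoopExtension N q w u` says that `u` arises from `w` by inserting loops of the automaton `N`
into the run of `N` on `w` that starts in the state `q`. -/
inductive LoopExtension : τ → List A → List A → Prop
  | nil (q : τ) : LoopExtension q [] []
  | cons {q : τ} {a : A} {w u : List A} :
      LoopExtension (N.step q a) w u → LoopExtension q (a :: w) (a :: u)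
  | loop_append {q : τ} {l w u : List A} :
      N.evalFrom q l = q → LoopExtension q w u → LoopExtension q w (l ++ u)

/-- The run of the automaton `N` on a word, started in state `q`: each letter is recorded with the
state before it. The final state is recorded with `none`, so that it matches only a final state when
one run is a sublist of another. -/
def annotatedRun : τ → List A → List (τ × Option A)
  | q, [] => [(q, none)]
  | q, a :: w => (q, some a) :: annotatedRun (N.step q a) w

lemma exists_prefix_of_mem_annotatedRun {q : τ} {w : List A} {e : τ × Option A}
    (he : e ∈ annotatedRun N q w) : ∃ v, v <+: w ∧ e.1 = N.evalFrom q v := by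
  induction w generalizing q with
  | nil =>
    rw [annotatedRun, List.mem_singleton] at he
    exact ⟨[], List.nil_prefix, by simp [he]⟩
  | cons a w ih =>
    rw [annotatedRun, List.mem_cons] at he
    rcases he with rfl | he
    · exact ⟨[], List.nil_prefix, by simp⟩
    · obtain ⟨v, hv, hev⟩ := ih he
      exact ⟨a :: v, by simpa using hv, by simpa using hev⟩

lemma exists_loopExtension_of_annotatedRun_sublist {q q' : τ} {w w' : List A}
    (h : (annotatedRun N q w).Sublist (annotatedRun N q' w')) :
    ∃ l u : List A, w' = l ++ u ∧ N.evalFrom q' l = q ∧ LoopExtension N q w u := by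
  induction w' generalizing q q' w with
  | nil =>
    cases w with
    | nil =>
      obtain rfl : q = q' := by simpa [annotatedRun] using h
      exact ⟨[], [], rfl, rfl, .nil q⟩
    | cons a w =>
      have := h.subset (List.mem_cons_self ..)
      simp [annotatedRun] at this
  | cons b w' ih =>
    rw [annotatedRun] at h
    rcases List.sublist_cons_iff.1 h with h | ⟨r, hr, h⟩
    · obtain ⟨l, u, rfl, hl, hu⟩ := ih h
      exact ⟨b :: l, u, rfl, by simpa using hl, hu⟩
    · cases w with
      | nil => simp [annotatedRun] at hr
      | cons a w =>
        simp only [annotatedRun, List.cons.injEq, Prod.mk.injEq, Option.some.injEq] at hr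
        obtain ⟨⟨rfl, rfl⟩, rfl⟩ := hr
        obtain ⟨l, u, rfl, hl, hu⟩ := ih h
        exact ⟨[], a :: (l ++ u), rfl, rfl, (hu.loop_append hl).cons⟩

theorem partiallyWellOrderedOn_loopExtension [Finite A] {F : Set τ} (hF : F.Finite) (q : τ) :
    {w : List A | ∀ v, v <+: w → N.evalFrom q v ∈ F}.PartiallyWellOrderedOn
      (LoopExtension N q) := by
  have higman := Set.PartiallyWellOrderedOn.partiallyWellOrderedOn_sublistForall₂ (· = ·)
    ((hF.prod (Set.finite_univ (α := Option A))).partiallyWellOrderedOn (r := (· = ·)))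
  rw [Set.partiallyWellOrderedOn_iff_exists_lt] at higman ⊢
  intro w hw
  obtain ⟨i, j, hij, h⟩ := higman (fun n => annotatedRun N q (w n)) fun n e he => by
    obtain ⟨v, hv, hev⟩ := exists_prefix_of_mem_annotatedRun N he
    exact ⟨hev ▸ hw n v hv, trivial⟩
  obtain ⟨_, heq, hsub⟩ := List.sublistForall₂_iff.1 h
  rw [List.forall₂_eq_eq_eq] at heq
  obtain ⟨l, u, hlu, hl, hu⟩ := exists_loopExtension_of_annotatedRun_sublist N (heq ▸ hsub)
  exact ⟨i, j, hij, hlu ▸ hu.loop_append hl⟩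

variable {N} in
theorem LoopExtension.exists_pumped_word {G : Type*} [Group G] {ev : A → G} {Z : Subgroup G}
    [IsMulCommutative Z] {q : τ} {w u : List A} (h : LoopExtension N q w u) (x : G)
    (hZ : ∀ v l, N.evalFrom q (v ++ l) = N.evalFrom q v →
      x * wordEval ev v * wordEval ev l * (x * wordEval ev v)⁻¹ ∈ Z) :
    ∃ m ∈ Z, x * wordEval ev u = m * (x * wordEval ev w) ∧ ∀ k : ℕ, ∃ W : List A,
      (W.length : ℤ) = w.length + k * (u.length - w.length) ∧
      N.evalFrom q W = N.evalFrom q w ∧ x * wordEval ev W = m ^ k * (x * wordEval ev w) := by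
  induction h generalizing x with
  | nil q => exact ⟨1, one_mem _, by simp, fun k => ⟨[], by simp⟩⟩
  | @cons q a w u _ ih =>
    obtain ⟨m, hm, hmu, hW⟩ := ih (x * ev a) fun v l hvl => by
      simpa [mul_assoc] using hZ (a :: v) l (by simpa using hvl)
    refine ⟨m, hm, by simpa [mul_assoc] using hmu, fun k => ?_⟩
    obtain ⟨W, hlen, heval, hval⟩ := hW k
    refine ⟨a :: W, ?_, by simpa using heval, by simpa [mul_assoc] using hval⟩
    push_cast [List.length_cons]
    linear_combination hlen
  | @loop_append q l w u hl _ ih =>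
    obtain ⟨m, hm, hmu, hW⟩ := ih x hZ
    set c : G := x * wordEval ev l * x⁻¹ with hc
    have hcZ : c ∈ Z := by simpa using hZ [] l (by simpa using hl)
    refine ⟨c * m, mul_mem hcZ hm, ?_, fun k => ?_⟩
    · rw [mul_assoc c, ← hmu, wordEval_append, hc]; group
    · obtain ⟨W, hlen, heval, hval⟩ := hW k
      refine ⟨(List.replicate k l).flatten ++ W, ?_, ?_, ?_⟩
      · simp only [List.length_append, List.length_flatten, List.map_replicate,
          List.sum_replicate, smul_eq_mul]
        push_cast
        linear_combination hlen
      · rw [DFA.evalFrom_of_append, evalFrom_flatten_replicate N hl, heval]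
      · rw [(show Commute c m from setLike_mul_comm hcZ hm).mul_pow, mul_assoc (c ^ k), ← hval,
          wordEval_append, wordEval_flatten_replicate, hc, conj_pow]
        group

end LoopExtension

section ConjTracking

variable {G : Type*} [Group G] {A : Type*} {σ : Type*} (M : DFA A σ) (ev : A → G) (S : Set G)

/-- The automaton `M`, enhanced to remember the conjugate of `S` by the element represented by the
word read so far. Its loops represent, up to conjugation, elements of the centralizer of `S`. -/
def conjTrackingDFA : DFA A (σ × (S → G)) where
  step p a := (M.step p.1 a, fun s => (ev a)⁻¹ * p.2 s * ev a)
  start := (M.start, conjTuple S 1)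
  accept := {p | p.1 ∈ M.accept}

lemma eval_conjTrackingDFA (w : List A) :
    (conjTrackingDFA M ev S).eval w = (M.eval w, conjTuple S (wordEval ev w)) := by
  induction w using List.reverseRecOn with
  | nil => simp [conjTrackingDFA]
  | append_singleton w a ih =>
    rw [DFA.eval_append_singleton, DFA.eval_append_singleton, ih]
    simp [conjTrackingDFA, conjTuple, funext_iff, mul_assoc]

end ConjTracking

section StableLength

variable {G : Type*} [Group G] {A : Type*} {ev : A → G} {L : Language A}

theorem exists_arithmetic_words (hL : IsBiautomaticStructure ev L) (g : G) :
    ∃ (n₀ d : ℕ) (a c : ℤ), 0 < d ∧ ∀ k : ℕ, ∃ W ∈ L,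
      wordEval ev W = g ^ (n₀ + k * d) ∧ (W.length : ℤ) = a + k * c := by
  have := hL.finite
  obtain ⟨σ, _, M, hM⟩ := hL.regular
  obtain ⟨S, hS, hgS, _⟩ := exists_finite_isMulCommutative_centralizer hL g
  let N := conjTrackingDFA M ev S
  have heval : ∀ v, N.eval v = (M.eval v, conjTuple S (wordEval ev v)) :=
    eval_conjTrackingDFA M ev S
  choose w hwL hwg using fun n : ℕ => hL.exists_word (g ^ n)
  obtain ⟨i, j, hij, hext⟩ := Set.PartiallyWellOrderedOn.exists_lt (f := w)
    (partiallyWellOrderedOn_loopExtension N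
      (Set.finite_univ.prod (finite_conjTuple_prefix hL hS)) N.start)
    fun n v hv => by
      change N.eval v ∈ _
      rw [heval]
      exact ⟨trivial, w n, hwL n, hwg n ▸ pow_mem hgS n, v, hv, rfl⟩
  obtain ⟨m, -, hm, hW⟩ := hext.exists_pumped_word (ev := ev) (Z := Subgroup.centralizer S) 1
    fun v l hvl => by
      have hloop : N.eval (v ++ l) = N.eval v := hvl
      rw [heval, heval, Prod.mk.injEq] at hloop
      simpa using conjTuple_eq_iff.1 hloop.2.symm
  obtain rfl : m = g ^ (j - i) := by
    rw [one_mul, one_mul, hwg, hwg] at hm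
    rw [pow_sub g hij.le]
    exact eq_mul_inv_of_mul_eq hm.symm
  refine ⟨i, j - i, (w i).length, (w j).length - (w i).length, by omega, fun k => ?_⟩
  obtain ⟨W, hlen, hWeval, hval⟩ := hW k
  have hend : N.eval W = N.eval (w i) := hWeval
  rw [heval, heval, Prod.mk.injEq] at hend
  refine ⟨W, ?_, ?_, hlen⟩
  · rw [← hM, DFA.mem_accepts, hend.1, ← DFA.mem_accepts, hM]
    exact hwL i
  · rw [one_mul, one_mul, hwg, ← pow_mul, ← pow_add] at hval
    rw [hval, add_comm, mul_comm]

lemma abs_sub_mul_div_le {d : ℕ} (hd : 0 < d) {y a c C : ℝ} {n₀ k i : ℕ} (hi : i ≤ d)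
    (h : |y - (a + k * c)| ≤ C) :
    |y - (n₀ + k * d + i : ℕ) * (c / d)| ≤ C + |a| + (n₀ + d) * |c / d| := by
  have hsplit : y - (n₀ + k * d + i : ℕ) * (c / d) =
      (y - (a + k * c)) + a - (n₀ + i) * (c / d) := by
    push_cast
    field_simp
    ring
  have hoffset : |((n₀ : ℝ) + i) * (c / d)| ≤ (n₀ + d) * |c / d| := by
    rw [abs_mul, abs_of_nonneg (by positivity)]
    gcongr
  calc _ ≤ |y - (a + k * c)| + |a| + |((n₀ : ℝ) + i) * (c / d)| := by
        rw [hsplit]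
        exact (abs_sub _ _).trans (by gcongr; exact abs_add_le _ _)
    _ ≤ _ := by gcongr

theorem exists_rat_abs_length_sub_le (hL : IsBiautomaticStructure ev L) (g : G) :
    ∃ (r : ℚ) (C : ℝ), ∀ᶠ n : ℕ in atTop, ∀ v ∈ L, wordEval ev v = g ^ n →
      |(v.length : ℝ) - n * r| ≤ C := by
  obtain ⟨n₀, d, a, c, hd, hW⟩ := exists_arithmetic_words hL g
  obtain ⟨C, hC⟩ := exists_abs_length_sub_le hL ((Set.finite_Iio d).image (g ^ ·))
  refine ⟨c / d, C + |a| + (n₀ + d) * |(c / d : ℝ)|, ?_⟩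
  filter_upwards [eventually_ge_atTop n₀] with n hn v hv hvg
  obtain ⟨k, i, hi, rfl⟩ : ∃ k i, i < d ∧ n = n₀ + k * d + i :=
    ⟨(n - n₀) / d, (n - n₀) % d, Nat.mod_lt _ hd, by
      have := Nat.div_add_mod' (n - n₀) d
      omega⟩
  obtain ⟨W, hWL, hWg, hlen⟩ := hW k
  have hlen' : (W.length : ℝ) = a + k * c := by exact_mod_cast hlen
  have hvW := hC v hv W hWL ⟨i, hi, by simp [hvg, hWg, pow_add _ _ i, ← pow_mul_comm]⟩
  rw [hlen'] at hvW
  exact_mod_cast abs_sub_mul_div_le hd hi.le hvW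

lemma tendsto_div_of_abs_sub_le {f : ℕ → ℝ} {r C : ℝ}
    (h : ∀ᶠ n : ℕ in atTop, |f n - n * r| ≤ C) :
    Tendsto (fun n : ℕ => f n / n) atTop (𝓝 r) := by
  rw [tendsto_iff_norm_sub_tendsto_zero]
  refine squeeze_zero' (Eventually.of_forall fun _ => norm_nonneg _) ?_
    (tendsto_const_div_atTop_nhds_zero_nat C)
  filter_upwards [h, eventually_gt_atTop 0] with n hn hpos
  rw [Real.norm_eq_abs, show f n / n - r = (f n - n * r) / n by field_simp, abs_div, Nat.abs_cast]
  gcongr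

theorem exists_rat_tendsto_length_div (hL : IsBiautomaticStructure ev L) (g : G) :
    ∃ r : ℚ, ∀ w : ℕ → List A, (∀ᶠ n in atTop, w n ∈ L ∧ wordEval ev (w n) = g ^ n) →
      Tendsto (fun n : ℕ => ((w n).length : ℝ) / n) atTop (𝓝 (r : ℝ)) := by
  obtain ⟨r, C, hr⟩ := exists_rat_abs_length_sub_le hL g
  refine ⟨r, fun w hw => tendsto_div_of_abs_sub_le (C := C) ?_⟩
  filter_upwards [hr, hw] with n hn hwn using hn (w n) hwn.1 hwn.2

lemma exists_word_length_eq_wordLength {h : G} (hh : ∃ w ∈ L, wordEval ev w = h) :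
    ∃ w ∈ L, wordEval ev w = h ∧ w.length = wordLength ev L h := by
  obtain ⟨w, hw, hwh⟩ := hh
  exact Nat.sInf_mem (s := {n : ℕ | ∃ w ∈ L, wordEval ev w = h ∧ w.length = n})
    ⟨w.length, w, hw, hwh, rfl⟩

end StableLength

end Biaut

theorem mainTheorem6 {G : Type*} [Group G] {A : Type*} (ev : A → G) (L : Language A)
    (hL : Biaut.IsBiautomaticStructure ev L) (g : G) :
    (∀ w : ℕ → List A, (∀ n : ℕ, 1 ≤ n → w n ∈ L ∧ Biaut.wordEval ev (w n) = g ^ n) →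
      (∃ q : ℚ, Tendsto (fun n : ℕ => ((w n).length : ℝ) / n) atTop (𝓝 (q : ℝ))) ∧
      Tendsto (fun n : ℕ => ((w n).length : ℝ) / n) atTop (𝓝 (Biaut.stableLength ev L g))) ∧
    Tendsto (fun n : ℕ => (Biaut.wordLength ev L (g ^ n) : ℝ) / n) atTop
      (𝓝 (Biaut.stableLength ev L g)) ∧
    ∃ q : ℚ, Biaut.stableLength ev L g = (q : ℝ) := by
  obtain ⟨r, hr⟩ := Biaut.exists_rat_tendsto_length_div hL g
  choose v hvL hvg hvlen using fun n : ℕ =>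
    Biaut.exists_word_length_eq_wordLength (hL.exists_word (g ^ n))
  have hshort : Tendsto (fun n : ℕ => (Biaut.wordLength ev L (g ^ n) : ℝ) / n) atTop
      (𝓝 (r : ℝ)) := by
    simpa only [hvlen] using hr v (.of_forall fun n => ⟨hvL n, hvg n⟩)
  have hstable : Biaut.stableLength ev L g = r := hshort.limUnder_eq
  rw [hstable]
  have hall := fun w hw => hr w ((eventually_ge_atTop 1).mono hw)
  exact ⟨fun w hw => ⟨⟨r, hall w hw⟩, hall w hw⟩, hshort, r, rfl⟩
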